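/- All topological spaces are metrizable. A Souslin space is a metrizable space that is the image of a complete separable metric space under a continuous surjection; every topological space $X$ carries its Borel $\sigma$-algebra $\Sigma_X$, and products carry the product topology. A family of conditioning events on $X$ is a non-empty family $\mathcal{B}\subseteq\Sigma_X$ with $\emptyset\notin\mathcal{B}$. For a family $\mathcal{B}\subseteq\Sigma_X$, a conditional probability system (CPS) on $(X,\Sigma_X,\mathcal{B})$ is an array $\mu=(\mu(\cdot|B))_{B\in\mathcal{B}}$ of probability measures on $\Sigma_X$ such that $\mu(B|B)=1$ for all $B\in\mathcal{B}$, and $\mu(A|B)\,\mu(B|C)=\mu(A|C)$ whenever $A\in\Sigma_X$, $B,C\in\mathcal{B}$ and $A\subseteq B\subseteq C$. If $\mathcal{B}$ is a family of conditioning events on $X$, put $\mathcal{B}_{X\times Y}:=\{B\times Y: B\in\mathcal{B}\}$, and let $\Delta^{\mathcal{B}}(X\times Y)$ denote the set of CPSs on $(X\times Y,\Sigma_{X\times Y},\mathcal{B}_{X\times Y})$; similarly for $Z$ in place of $Y$. Let $X,Y,Z$ be Souslin spaces, let $\mathcal{B}\subseteq\Sigma_X$ be a countable family of conditioning events, let $f_1:Y\to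 Z$ be Borel measurable, and define $f_2:X\times Y\to X\times Z$ by $f_2(x,y):=(x,f_1(y))$. Then: (i) $f_2$ is Borel measurable, and the pushforward-CPS map $\overline{\mathcal{L}}_{f_2}:\Delta^{\mathcal{B}}(X\times Y)\to\Delta^{\mathcal{B}}(X\times Z)$, $\overline{\mathcal{L}}_{f_2}(\mu)(E|C):=\mu(f_2^{-1}(E)\,|\,f_2^{-1}(C))$ for $E\in\Sigma_{X\times Z}$ and $C\in\mathcal{B}_{X\times Z}$, is well defined; that is, $\{f_2^{-1}(C):C\in\mathcal{B}_{X\times Z}\}=\mathcal{B}_{X\times Y}$, and $\overline{\mathcal{L}}_{f_2}(\mu)$ is a CPS on $(X\times Z,\Sigma_{X\times Z},\mathcal{B}_{X\times Z})$ for every $\mu\in\Delta^{\mathcal{B}}(X\times Y)$; (ii) if $f_1$ is surjective, then $\overline{\mathcal{L}}_{f_2}:\Delta^{\mathcal{B}}(X\times Y)\to\Delta^{\mathcal{B}}(X\times Z)$ is surjective. -/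

import Mathlib

open MeasureTheory

/-- A (metrizable) Souslin space: a metrizable space which is the image of a complete separable
metric space under a continuous surjection. (Every complete separable metric space is, up to
isometry, one with carrier in `Type`, so the choice of universe is immaterial.) -/
class SouslinSpace (X : Type*) [TopologicalSpace X] : Prop
    extends TopologicalSpace.MetrizableSpace X where
  exists_continuous_surjective :
    ∃ (P : Type) (_ : MetricSpace P) (_ : CompleteSpace P)
      (_ : TopologicalSpace.SeparableSpace P) (p : P → X),
      Continuous p ∧ Function.Surjective p

instance SouslinSpace.secondCountableTopology (X : Type*) [TopologicalSpace X] [SouslinSpace X] :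
    SecondCountableTopology X := by
  obtain ⟨P, _, _, _, p, hp, hs⟩ := SouslinSpace.exists_continuous_surjective (X := X)
  haveI : TopologicalSpace.SeparableSpace X := hs.denseRange.separableSpace hp
  letI := TopologicalSpace.metrizableSpaceMetric X
  exact UniformSpace.secondCountable_of_separable X

/-- For Souslin spaces the product `σ`-algebra on `X × Y` (Mathlib's instance) is the Borel
`σ`-algebra of the product topology. -/
theorem SouslinSpace.borelSpace_prod (X Y : Type*)
    [TopologicalSpace X] [SouslinSpace X] [MeasurableSpace X] [BorelSpace X]
    [TopologicalSpace Y] [SouslinSpace Y] [MeasurableSpace Y] [BorelSpace Y] :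
    BorelSpace (X × Y) := inferInstance

/-- A family of conditioning events: a non-empty family of measurable sets that does not include
the empty set. -/
structure IsConditioningFamily {X : Type*} [MeasurableSpace X] (B : Set (Set X)) : Prop where
  nonempty : B.Nonempty
  measurableSet : ∀ b ∈ B, MeasurableSet b
  empty_notMem : ∅ ∉ B

/-- The family `f ⁻¹(F)` of all preimages under `f` of members of the family `F`. -/
def preimageFamily {X Y : Type*} (f : X → Y) (F : Set (Set Y)) : Set (Set X) :=
  {E | ∃ b ∈ F, E = f ⁻¹' b}

/-- The family of cylinders `b × Y` with `b ∈ B`, as a family of subsets of `X × Y`. -/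
def cylinderFamily {X : Type*} (B : Set (Set X)) (Y : Type*) : Set (Set (X × Y)) :=
  preimageFamily (Prod.fst : X × Y → X) B

theorem IsConditioningFamily.cylinderFamily {X Y : Type*} [MeasurableSpace X] [MeasurableSpace Y]
    [Nonempty Y] {B : Set (Set X)} (hB : IsConditioningFamily B) :
    IsConditioningFamily (cylinderFamily B Y) where
  nonempty := by
    obtain ⟨b, hb⟩ := hB.nonempty
    exact ⟨_, b, hb, rfl⟩
  measurableSet := by
    rintro _ ⟨b, hb, rfl⟩
    exact measurable_fst (hB.measurableSet b hb)
  empty_notMem := by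
    rintro ⟨b, hb, h⟩
    have : b = ∅ := by
      have h' := congrArg (Prod.fst '' ·) h
      simpa [Set.image_preimage_eq _ Prod.fst_surjective] using h'.symm
    exact hB.empty_notMem (this ▸ hb)

/-- The set `Δ^B(X)` of conditional probability systems on `X` with conditioning events `B`:
arrays `(μ(· | b))`, `b ∈ B`, of probability measures on `X` such that `μ(b | b) = 1` and the
chain rule holds. -/
def CPS (X : Type*) [MeasurableSpace X] (B : Set (Set X)) : Set (B → ProbabilityMeasure X) :=
  {μ | (∀ b : B, (μ b : Measure X) (b : Set X) = 1) ∧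
    ∀ (A : Set X) (b c : B), MeasurableSet A → A ⊆ (b : Set X) → (b : Set X) ⊆ (c : Set X) →
      (μ b : Measure X) A * (μ c : Measure X) (b : Set X) = (μ c : Measure X) A}

/-- The pushforward of an array of probability measures on `X` indexed by `BX = f ⁻¹(BY)`: for
`b ∈ BY`, its entry at `b` is the image measure under `f` of `μ(· | f ⁻¹(b))`. -/
noncomputable def pushforwardCPS {X Y : Type*} [MeasurableSpace X] [MeasurableSpace Y]
    {BX : Set (Set X)} {BY : Set (Set Y)} (f : X → Y) (hf : Measurable f)
    (hB : preimageFamily f BY = BX) (μ : BX → ProbabilityMeasure X) :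
    BY → ProbabilityMeasure Y :=
  fun b => (μ ⟨f ⁻¹' (b : Set Y), hB ▸ ⟨(b : Set Y), b.2, rfl⟩⟩).map hf.aemeasurable

open Set Filter Topology

/-! For surjectivity, push ν forward along (x, z) ↦ (x, s z), where s is a Borel map with f₁ (s z) =
z almost everywhere. As `B` is countable, s can be chosen for the sum of all the Z-marginals of ν at
once. The first coordinate is untouched, so the chain rule survives. To get s, parametrize Y by the
Baire space so that the composite to Z is continuous, and take the lexicographically least point of
each fibre. This choice is measurable up to null sets because analytic sets are universally
measurable. -/

/-! ### Universal measurability of analytic sets -/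

theorem isCompact_setOf_forall_le (N : ℕ → ℕ) : IsCompact {x : ℕ → ℕ | ∀ i, x i ≤ N i} := by
  convert isCompact_univ_pi fun i => (finite_Iic (N i)).isCompact using 1
  ext
  simp [Pi.le_def]

/-- Truncating counterexamples at `N` puts them in a compact set; since coordinates below n are
unchanged, the untruncated subsequence has the same limit, inside `V`. -/
theorem exists_cylinder_subset_of_isOpen {N : ℕ → ℕ} {V : Set (ℕ → ℕ)} (hV : IsOpen V)
    (hN : {x : ℕ → ℕ | ∀ i, x i ≤ N i} ⊆ V) : ∃ n, {x : ℕ → ℕ | ∀ i < n, x i ≤ N i} ⊆ V := by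
  by_contra! h
  simp only [not_subset] at h
  choose x hx hxV using h
  obtain ⟨y, hy, φ, hφ, hlim⟩ := (isCompact_setOf_forall_le N).tendsto_subseq
    (x := fun n i => min (x n i) (N i)) fun n i => min_le_right _ _
  have hlim' : Tendsto (x ∘ φ) atTop (𝓝 y) := by
    rw [tendsto_pi_nhds] at hlim ⊢
    intro i
    refine (hlim i).congr' ?_
    filter_upwards [eventually_gt_atTop i] with n hn
    exact min_eq_left (hx _ i (hn.trans_le (hφ.id_le n)))
  obtain ⟨n, hn⟩ := (hlim'.eventually (hV.mem_nhds (hN hy))).exists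
  exact hxV _ hn

/-- Coordinates are bounded one at a time: continuity from below along increasing unions needs no
measurability of the images. -/
theorem exists_seq_lt_measure_image {Z : Type*} [MeasurableSpace Z] (μ : Measure Z)
    (g : (ℕ → ℕ) → Z) {c : ENNReal} (hc : c < μ (range g)) :
    ∃ N : ℕ → ℕ, ∀ n, c < μ (g '' {x | ∀ i < n, x i ≤ N i}) := by
  have step : ∀ (n : ℕ) (S : {S : Set (ℕ → ℕ) // c < μ (g '' S)}),
      ∃ k, c < μ (g '' (S.1 ∩ {x | x n ≤ k})) := by
    rintro n ⟨S, hS⟩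
    have hU : g '' S = ⋃ k, g '' (S ∩ {x | x n ≤ k}) := by
      rw [← image_iUnion, ← inter_iUnion]
      congr 1
      ext x
      simpa using fun _ => ⟨x n, le_rfl⟩
    have hmono : Monotone fun k : ℕ => g '' (S ∩ {x | x n ≤ k}) := fun a b hab =>
      image_mono (inter_subset_inter_right _ fun x (hx : x n ≤ a) => hx.trans hab)
    rw [hU, hmono.directed_le.measure_iUnion] at hS
    exact lt_iSup_iff.1 hS
  choose k hk using step
  let S : ℕ → {S : Set (ℕ → ℕ) // c < μ (g '' S)} := fun n =>
    Nat.rec ⟨univ, by simpa using hc⟩ (fun n S => ⟨_, hk n S⟩) n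
  refine ⟨fun n => k n (S n), fun n => ?_⟩
  convert (S n).2
  induction n with
  | zero => simp [S]
  | succ n ih =>
    have : (S (n + 1)).1 = (S n).1 ∩ {x | x n ≤ k n (S n)} := rfl
    rw [this, ← ih]
    ext x
    simp only [mem_ofPred_eq, mem_inter_iff, Nat.forall_lt_succ_right]

theorem exists_isCompact_subset_range_le_measure {Z : Type*} [TopologicalSpace Z]
    [MeasurableSpace Z] [BorelSpace Z] (μ : Measure Z) [μ.OuterRegular]
    {g : (ℕ → ℕ) → Z} (hg : Continuous g) {c : ENNReal} (hc : c < μ (range g)) :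
    ∃ K ⊆ range g, IsCompact K ∧ c ≤ μ K := by
  obtain ⟨N, hN⟩ := exists_seq_lt_measure_image μ g hc
  refine ⟨g '' {x | ∀ i, x i ≤ N i}, image_subset_range _ _, 
    (isCompact_setOf_forall_le N).image hg, ?_⟩
  -- Continuity from above may fail for the non-measurable images; instead, every open set
  -- containing the compact image contains the image of some cylinder.
  rw [Set.measure_eq_iInf_isOpen]
  refine le_iInf₂ fun U hU => le_iInf fun hUo => ?_
  obtain ⟨n, hn⟩ := exists_cylinder_subset_of_isOpen (hUo.preimage hg) (image_subset_iff.1 hU)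
  exact (hN n).le.trans (measure_mono (image_subset_iff.2 hn))

/-- Analytic sets are universally measurable. -/
theorem MeasureTheory.AnalyticSet.nullMeasurableSet {Z : Type*} [TopologicalSpace Z]
    [TopologicalSpace.MetrizableSpace Z] [MeasurableSpace Z] [BorelSpace Z] {A : Set Z}
    (hA : AnalyticSet A) (μ : Measure Z) [IsFiniteMeasure μ] : NullMeasurableSet A μ := by
  rw [AnalyticSet] at hA
  obtain rfl | ⟨g, hg, rfl⟩ := hA
  · exact nullMeasurableSet_empty
  let := TopologicalSpace.metrizableSpaceMetric Z
  obtain h0 | h0 := eq_or_ne (μ (range g)) 0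
  · exact NullMeasurableSet.of_null h0
  obtain ⟨u, -, hu, hlim⟩ := exists_seq_strictMono_tendsto' (pos_iff_ne_zero.2 h0)
  choose K hKs hK hKu using fun n =>
    exists_isCompact_subset_range_le_measure μ hg (hu n).2
  have hm : MeasurableSet (⋃ n, K n) := .iUnion fun n => (hK n).measurableSet
  refine hm.nullMeasurableSet.congr ?_
  refine ae_eq_of_subset_of_measure_ge (iUnion_subset hKs) ?_ hm.nullMeasurableSet
    (measure_ne_top _ _)
  exact le_of_tendsto' hlim fun n => (hKu n).trans (measure_mono (subset_iUnion K n))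

/-! ### Measurable sections -/

/-- A non-empty closed subset of the Baire space has a lexicographically least element. -/
theorem IsClosed.exists_lex_least {F : Set (ℕ → ℕ)} (hF : IsClosed F) (hne : F.Nonempty) :
    ∃ a ∈ F, ∀ n, ∀ x ∈ F, (∀ i < n, x i = a i) → a n ≤ x n := by
  have step : ∀ (n : ℕ) (S : {S : Set (ℕ → ℕ) // S.Nonempty}), ∃ k,
      (S.1 ∩ {x | x n = k}).Nonempty ∧ ∀ x ∈ S.1, k ≤ x n := by
    rintro n ⟨S, hS⟩
    obtain ⟨x, hx, hk⟩ := Nat.sInf_mem (hS.image fun x => x n)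
    exact ⟨_, ⟨x, hx, hk⟩, fun y hy => Nat.sInf_le ⟨y, hy, rfl⟩⟩
  choose k hk hmin using step
  let S : ℕ → {S : Set (ℕ → ℕ) // S.Nonempty} := fun n =>
    Nat.rec ⟨F, hne⟩ (fun n S => ⟨_, hk n S⟩) n
  have hS : ∀ n, (S n).1 = {x ∈ F | ∀ i < n, x i = k i (S i)} := by
    intro n
    induction n with
    | zero => simp [S]
    | succ n ih =>
      have : (S (n + 1)).1 = (S n).1 ∩ {x | x n = k n (S n)} := rfl
      rw [this, ih]
      ext x
      simp only [mem_ofPred_eq, mem_inter_iff, Nat.forall_lt_succ_right, and_assoc]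
  choose x hx using fun n => (S n).2
  simp only [hS] at hx
  refine ⟨fun n => k n (S n), ?_, fun n y hy h => hmin n (S n) y (hS n ▸ ⟨hy, h⟩)⟩
  refine hF.mem_of_tendsto (b := atTop) (f := x) ?_ (Eventually.of_forall fun n => (hx n).1)
  rw [tendsto_pi_nhds]
  intro i
  refine tendsto_const_nhds.congr' ?_
  filter_upwards [eventually_gt_atTop i] with n hn
  exact ((hx n).2 i hn).symm

theorem Continuous.exists_aemeasurable_rightInverse {Z : Type*} [TopologicalSpace Z]
    [TopologicalSpace.MetrizableSpace Z] [MeasurableSpace Z] [BorelSpace Z]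
    {g : (ℕ → ℕ) → Z} (hg : Continuous g) (hs : Function.Surjective g)
    (μ : Measure Z) [IsFiniteMeasure μ] :
    ∃ s : Z → ℕ → ℕ, AEMeasurable s μ ∧ Function.RightInverse s g := by
  choose s hsg hmin using fun z =>
    (isClosed_singleton.preimage hg : IsClosed (g ⁻¹' {z})).exists_lex_least (hs z)
  refine ⟨s, aemeasurable_pi_iff.2 fun n => ?_, hsg⟩
  have hA : ∀ (u : ℕ → ℕ) (n j : ℕ),
      NullMeasurableSet (g '' {x | (∀ i < n, x i = u i) ∧ x n = j}) μ := by
    intro u n j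
    have hc : IsClosed {x : ℕ → ℕ | (∀ i < n, x i = u i) ∧ x n = j} := by
      simp only [ofPred_and, ofPred_forall]
      exact (isClosed_iInter fun i => isClosed_iInter fun _ =>
        isClosed_eq (continuous_apply i) continuous_const).inter
          (isClosed_eq (continuous_apply n) continuous_const)
    exact (hc.analyticSet.image_of_continuous hg).nullMeasurableSet μ
  have hcyl : ∀ (u : ℕ → ℕ) (n : ℕ), NullMeasurableSet {z | ∀ i < n, s z i = u i} μ := by
    intro u n
    induction n with
    | zero => simp
    | succ n ih =>
      -- The least point continues the prefix by `u n` iff the fibre meets that cylinder but none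
      -- with a smaller `n`-th entry.
      have : {z | ∀ i < n + 1, s z i = u i} = ({z | ∀ i < n, s z i = u i} ∩
          g '' {x | (∀ i < n, x i = u i) ∧ x n = u n}) \
          ⋃ j, ⋃ (_ : j < u n), g '' {x | (∀ i < n, x i = u i) ∧ x n = j} := by
        ext z
        simp only [Nat.forall_lt_succ_right, mem_ofPred_eq, Set.mem_sdiff, mem_inter_iff, mem_image,
          mem_iUnion, not_exists]
        constructor
        · rintro ⟨h, hn⟩
          refine ⟨⟨h, s z, ⟨h, hn⟩, hsg z⟩, ?_⟩
          rintro j hj x ⟨⟨hx, rfl⟩, hxz⟩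
          exact absurd (hmin z n x hxz fun i hi => (hx i hi).trans (h i hi).symm) (by omega)
        · rintro ⟨⟨h, x, ⟨hx, hxn⟩, hxz⟩, hj⟩
          have hle := hmin z n x hxz fun i hi => (hx i hi).trans (h i hi).symm
          refine ⟨h, (hle.trans hxn.le).antisymm ?_⟩
          by_contra! hlt
          exact hj _ hlt (s z) ⟨⟨h, rfl⟩, hsg z⟩
      rw [this]
      exact (ih.inter (hA u n _)).diff (.iUnion fun j => .iUnion fun _ => hA u n j)
  have hk : ∀ k, NullMeasurableSet {z | s z n = k} μ := by
    intro k
    -- Only countably many prefixes of length `n + 1` occur; the value 0 beyond them is never read.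
    have : {z | s z n = k} = ⋃ u : Fin (n + 1) → ℕ, ⋃ (_ : u (Fin.last n) = k),
        {z | ∀ i < n + 1, s z i = if h : i < n + 1 then u ⟨i, h⟩ else 0} := by
      ext z
      simp only [mem_ofPred_eq, mem_iUnion, exists_prop]
      constructor
      · exact fun h => ⟨fun i => s z i, h, fun i hi => by simp [hi]⟩
      · rintro ⟨u, rfl, h⟩
        simpa [Fin.last] using h n n.lt_succ_self
    rw [this]
    exact .iUnion fun u => .iUnion fun _ => hcyl _ _
  refine NullMeasurable.aemeasurable fun t _ => ?_
  have : (fun z => s z n) ⁻¹' t = ⋃ k ∈ t, {z | s z n = k} := by ext; simp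
  rw [this]
  exact .biUnion t.to_countable fun k _ => hk k

/-- A finer Polish topology on `P` makes `f` continuous; parametrize that one. -/
theorem Measurable.exists_nat_nat_continuous_comp {P Z : Type*}
    [tP : TopologicalSpace P] [PolishSpace P] [MeasurableSpace P] [BorelSpace P] [Nonempty P]
    [TopologicalSpace Z] [SecondCountableTopology Z] [MeasurableSpace Z] [OpensMeasurableSpace Z]
    {f : P → Z} (hf : Measurable f) :
    ∃ q : (ℕ → ℕ) → P, Continuous q ∧ Function.Surjective q ∧ Continuous (f ∘ q) := by
  obtain ⟨t, ht, hft, hPt⟩ := hf.exists_continuous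
  obtain ⟨q, hq, hqs⟩ := @PolishSpace.exists_nat_nat_continuous_surjective P t hPt _
  exact ⟨q, continuous_le_rng ht hq, hqs, @Continuous.comp _ _ _ _ t _ _ _ hft hq⟩

/-- A Borel surjection from a Souslin space has a Borel right inverse almost everywhere. -/
theorem Measurable.exists_measurable_ae_rightInverse {Y Z : Type*}
    [TopologicalSpace Y] [SouslinSpace Y] [MeasurableSpace Y] [BorelSpace Y]
    [TopologicalSpace Z] [SouslinSpace Z] [MeasurableSpace Z] [BorelSpace Z]
    {f : Y → Z} (hf : Measurable f) (hs : Function.Surjective f) (μ : Measure Z) [SFinite μ] :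
    ∃ s : Z → Y, Measurable s ∧ ∀ᵐ z ∂μ, f (s z) = z := by
  obtain hY | hY := isEmpty_or_nonempty Y
  · have : IsEmpty Z := hs.isEmpty
    exact ⟨isEmptyElim, measurable_of_empty _, ae_of_all _ isEmptyElim⟩
  obtain ⟨P, _, _, _, p, hp, hps⟩ := SouslinSpace.exists_continuous_surjective (X := Y)
  have : Nonempty P := hps.nonempty
  have : SecondCountableTopology P := UniformSpace.secondCountable_of_separable P
  let : MeasurableSpace P := borel P
  have : BorelSpace P := ⟨rfl⟩
  obtain ⟨q, hq, hqs, hfpq⟩ := (hf.comp hp.measurable).exists_nat_nat_continuous_comp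
  have hpq : Continuous (p ∘ q) := hp.comp hq
  -- `μ.toFinite` is a finite measure with the same null sets as `μ`.
  obtain ⟨s, hsm, hsr⟩ :=
    hfpq.exists_aemeasurable_rightInverse (hs.comp (hps.comp hqs)) μ.toFinite
  refine ⟨(p ∘ q) ∘ hsm.mk s, hpq.measurable.comp hsm.measurable_mk, ?_⟩
  rw [← ae_toFinite]
  filter_upwards [hsm.ae_eq_mk] with z hz
  simpa [← hz] using hsr z

/-! ### Pushforwards of conditional probability systems -/

theorem preimageFamily_cylinderFamily {X Y Z : Type*} (B : Set (Set X)) {f : X × Y → X × Z}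
    (hf : ∀ w, (f w).1 = w.1) :
    preimageFamily f (cylinderFamily B Z) = cylinderFamily B Y := by
  have h : ∀ b : Set X, f ⁻¹' (Prod.fst ⁻¹' b) = Prod.fst ⁻¹' b := fun b => by
    ext w; simp [hf]
  ext E
  constructor
  · rintro ⟨_, ⟨b, hb, rfl⟩, rfl⟩
    exact ⟨b, hb, h b⟩
  · rintro ⟨b, hb, rfl⟩
    exact ⟨_, ⟨b, hb, rfl⟩, (h b).symm⟩

theorem measurableSet_of_mem_cylinderFamily {X Y : Type*} [MeasurableSpace X] [MeasurableSpace Y]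
    {B : Set (Set X)} (hB : IsConditioningFamily B) :
    ∀ b ∈ cylinderFamily B Y, MeasurableSet b := by
  rintro _ ⟨b, hb, rfl⟩
  exact measurable_fst (hB.measurableSet b hb)

theorem pushforwardCPS_mapsTo {X Y : Type*} [MeasurableSpace X] [MeasurableSpace Y]
    {BX : Set (Set X)} {BY : Set (Set Y)} {f : X → Y} (hf : Measurable f)
    (hB : preimageFamily f BY = BX) (hBY : ∀ b ∈ BY, MeasurableSet b) :
    MapsTo (pushforwardCPS f hf hB) (CPS X BX) (CPS Y BY) := by
  rintro μ ⟨h1, h2⟩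
  have hmap : ∀ (b : BY) {A : Set Y}, MeasurableSet A →
      (pushforwardCPS f hf hB μ b : Measure Y) A =
        (μ ⟨f ⁻¹' b, hB ▸ ⟨b, b.2, rfl⟩⟩ : Measure X) (f ⁻¹' A) := fun b A hA => by
    simp [pushforwardCPS, Measure.map_apply hf hA]
  refine ⟨fun b => ?_, fun A b c hA hAb hbc => ?_⟩
  · rw [hmap b (hBY b b.2)]
    exact h1 _
  · rw [hmap b hA, hmap c hA, hmap c (hBY b b.2)]
    exact h2 _ ⟨f ⁻¹' b, _⟩ ⟨f ⁻¹' c, _⟩ (hf hA) (preimage_mono hAb) (preimage_mono hbc)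

theorem lemma3 {X Y Z : Type*}
    [TopologicalSpace X] [SouslinSpace X] [MeasurableSpace X] [BorelSpace X]
    [TopologicalSpace Y] [SouslinSpace Y] [MeasurableSpace Y] [BorelSpace Y]
    [TopologicalSpace Z] [SouslinSpace Z] [MeasurableSpace Z] [BorelSpace Z]
    (B : Set (Set X)) (hB : IsConditioningFamily B) (hBc : B.Countable)
    (f₁ : Y → Z) (hf₁ : Measurable f₁)
    (f₂ : X × Y → X × Z) (hf₂ : ∀ x y, f₂ (x, y) = (x, f₁ y)) :
    ∃ (hm : Measurable f₂)
      (hpre : preimageFamily f₂ (cylinderFamily B Z) = cylinderFamily B Y),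
      Set.MapsTo (pushforwardCPS f₂ hm hpre)
        (CPS (X × Y) (cylinderFamily B Y)) (CPS (X × Z) (cylinderFamily B Z)) ∧
      (Function.Surjective f₁ →
        Set.SurjOn (pushforwardCPS f₂ hm hpre)
          (CPS (X × Y) (cylinderFamily B Y)) (CPS (X × Z) (cylinderFamily B Z))) := by
  obtain rfl : f₂ = fun w => (w.1, f₁ w.2) := funext fun w => hf₂ w.1 w.2
  have hm : Measurable fun w : X × Y => (w.1, f₁ w.2) :=
    measurable_fst.prodMk (hf₁.comp measurable_snd)
  refine ⟨hm, preimageFamily_cylinderFamily B fun _ => rfl, pushforwardCPS_mapsTo hm _ 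
    (measurableSet_of_mem_cylinderFamily hB),
    fun hs ν hν => ?_⟩
  have : Countable (cylinderFamily B Z) := by
    have h : cylinderFamily B Z = (fun b => Prod.fst ⁻¹' b) '' B := by
      ext E
      exact ⟨fun ⟨b, hb, h⟩ => ⟨b, hb, h.symm⟩, fun ⟨b, hb, h⟩ => ⟨b, hb, h.symm⟩⟩
    rw [h]
    exact (hBc.image _).to_subtype
  -- A null set of the sum is null for every marginal, so one s serves all conditioning events.
  obtain ⟨s, hsm, hsf⟩ := hf₁.exists_measurable_ae_rightInverse hs
    (Measure.sum fun c => (ν c : Measure (X × Z)).map Prod.snd)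
  rw [Measure.ae_sum_iff] at hsf
  have hk : Measurable fun w : X × Z => (w.1, s w.2) :=
    measurable_fst.prodMk (hsm.comp measurable_snd)
  refine ⟨pushforwardCPS _ hk (preimageFamily_cylinderFamily B fun _ => rfl) ν,
    pushforwardCPS_mapsTo hk _ (measurableSet_of_mem_cylinderFamily hB) hν, ?_⟩
  funext c
  obtain ⟨_, b, hb, rfl⟩ := c
  apply Subtype.ext
  change ((ν ⟨_, b, hb, rfl⟩ : Measure (X × Z)).map _).map _ = (ν ⟨_, b, hb, rfl⟩ : Measure (X × Z))
  rw [Measure.map_map hm hk]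
  conv_rhs => rw [← Measure.map_id (μ := (ν ⟨_, b, hb, rfl⟩ : Measure (X × Z)))]
  refine Measure.map_congr ?_
  filter_upwards [ae_of_ae_map measurable_snd.aemeasurable (hsf ⟨_, b, hb, rfl⟩)] with w hw
  exact Prod.ext rfl hw
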